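/- Let $k$ be a field of characteristic $p>0$, let $\ell\neq p$ be a prime, let $n\ge 1$, and put $\Lambda_n=\mathbb Z/\ell^n\mathbb Z$. For a $\Lambda_n$-module $V$ let $V^*=\{v\in V:\ \ell^{n-1}v\neq 0\}$ and $P_n(V)=V^*/\Lambda_n^*$. For a sheaf $\mathcal V$ of $\Lambda_n$-modules on the small étale site of a scheme $U$ let $\mathcal V^*\subset\mathcal V$ be the subsheaf of sections $s$ such that $\ell^{n-1}s$ does not vanish on any nonempty étale scheme over the domain of $s$, and let $P_n(\mathcal V)$ be the quotient sheaf $\mathcal V^*/\Lambda_n^*$. Let $U$ be a smooth (connected) curve over $k$ and let $\bar a:\operatorname{Spec}K\to U$ be a geometric point, with $K$ separably closed. Let $\pi_1(U,\bar a)$ be the automorphism group of the functor $T\mapsto \operatorname{Hom}_U(\operatorname{Spec}K,T)$ from finite étale $U$-schemes to sets; it acts on the stalk $\mathcal V_{\bar a}$ of a locally constant sheaf $\mathcal V$ of finite $\Lambda_n$-modules, and hence on $P_n(\mathcal V_{\bar a})$: if $\mathcal V$ is constant on the finite étale $U$-scheme $T$, then $\sigma$ maps the germ of $s\in\mathcal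 V(T)$ at $t\in T(K)$ to its germ at $\sigma t$. An action is called transitive if it has exactly one orbit (in particular, the set is not empty), and connected schemes are nonempty. (1) Let $\mathcal V_n$ be a locally constant sheaf of free $\Lambda_n$-modules of finite rank on the small étale site of $U$. Let $U_n$ be the finite étale $U$-scheme that represents $P_n(\mathcal V_n)$, and let $C_n$ be a regular projectivisation of $U_n$, that is, a regular projective $k$-scheme that contains $U_n$ as a dense open subscheme. If the action of $\pi_1(U,\bar a)$ on $P_n((\mathcal V_n)_{\bar a})$ is transitive, then $C_n$ is connected. (2) Let $f_U:X_U\to U$ be a smooth proper morphism, let $i\ge 0$, and let $\mathcal V_n=R^i f_{U*}\Lambda_n$, a locally constant sheaf of finite $\Lambda_n$-modules on the small étale site of $U$. Let $U_n$ be the finite étale $U$-scheme that represents $P_n(\mathcal V_n)$, and let $C_n$ be a regular projectivisation of $U_n$. Let $X_{\bar a}$ be the fibre of $X_U$ over $\bar a$, and let $\pi_1(U,\bar a)$ act on $H^i_{\text{ét}}(X_{\bar a},\Lambda_n)$ through the base change isomorphism $(\mathcal V_n)_{\bar a}\cong H^i_{\text{ét}}(X_{\bar a},\Lambda_n)$.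 If this action is transitive on $P_n(H^i_{\text{ét}}(X_{\bar a},\Lambda_n))$, then $C_n$ is connected. -/

import Mathlib

open CategoryTheory Limits Opposite AlgebraicGeometry

universe u

noncomputable section

namespace TowerCurves

/-! ## The projectivisation of a module -/

section Projectivisation

/-- The ring `Λ_n = ℤ/ℓⁿ` (in the universe `u`). -/
abbrev Lam (ℓ n : ℕ) : Type u := ULift.{u} (ZMod (ℓ ^ n))

/-- `Λ_n` as a module over itself. -/
abbrev LamMod (ℓ n : ℕ) : ModuleCat.{u} (Lam.{u} ℓ n) := ModuleCat.of _ (Lam.{u} ℓ n)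

variable (ℓ n : ℕ) (V : Type u) [AddCommGroup V] [Module (Lam.{u} ℓ n) V]

/-- `V^* = {v ∈ V | ℓ^(n-1) v ≠ 0}`, which is stable under the units of `Λ_n`. -/
def starSet : SubMulAction (Lam.{u} ℓ n)ˣ V where
  carrier := {v | ℓ ^ (n - 1) • v ≠ 0}
  smul_mem' c v hv h := hv ((smul_eq_zero_iff_eq c).1 (by rw [smul_comm]; exact h))

/-- The projectivisation `P_n(V) = V^* / Λ_n^*`. -/
def ProjSet : Type u := MulAction.orbitRel.Quotient (Lam.{u} ℓ n)ˣ (starSet ℓ n V)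

variable {V} in
/-- The class in `P_n(V)` of an element of `V^*`. -/
def ProjSet.mk (v : starSet ℓ n V) : ProjSet ℓ n V := Quotient.mk _ v

/-- Let a group `G` act on the module `V`, the action being given by its graph
`act σ v w`, meaning `σ v = w`. The proposition says that the induced action of `G` on `P_n(V)`
is transitive, i.e. that it has exactly one orbit (so `P_n(V)` is not empty). -/
def TransitiveOnProj {G : Type*} (act : G → V → V → Prop) : Prop :=
  Nonempty (ProjSet ℓ n V) ∧
    ∀ P Q : ProjSet ℓ n V, ∃ (σ : G) (v w : starSet ℓ n V),
      ProjSet.mk ℓ n v = P ∧ ProjSet.mk ℓ n w = Q ∧ act σ v w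

end Projectivisation

/-! ## Étale sheaves of modules and direct images -/

/-- Sheaves of `R`-modules on the small étale site of `X`. -/
abbrev EtSheaf (X : Scheme.{u}) (R : Type u) [CommRing R] :=
  Sheaf X.smallEtaleTopology (ModuleCat.{u} R)

/-- The constant sheaf on the small étale site of `X` with value `M`. -/
abbrev constSheaf (X : Scheme.{u}) {R : Type u} [CommRing R] (M : ModuleCat.{u} R) :
    EtSheaf X R :=
  (constantSheaf X.smallEtaleTopology (ModuleCat.{u} R)).obj M

instance {X Y : Scheme.{u}} (f : X ⟶ Y) : MorphismProperty.HasPullbacksAlong (@Etale.{u}) f where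
  hasPullback _ _ := inferInstance
instance {X Y : Scheme.{u}} (f : X ⟶ Y) :
    MorphismProperty.IsStableUnderBaseChangeAlong (@Etale.{u}) f where
  of_isPullback h := Etale.etale_isStableUnderBaseChange.of_isPullback h

/-- Base change along `f` of schemes étale over the target of `f`. -/
def etalePullback {X Y : Scheme.{u}} (f : X ⟶ Y) : Y.Etale ⥤ X.Etale :=
  MorphismProperty.Over.pullback @Etale ⊤ f

/-- The functor `etalePullback f` is the usual base change of schemes. -/
def etalePullbackForget {X Y : Scheme.{u}} (f : X ⟶ Y) :
    etalePullback f ⋙ Scheme.Etale.forget X ≅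
      Scheme.Etale.forget Y ⋙ CategoryTheory.Over.pullback f :=
  MorphismProperty.Over.pullbackCompForgetIso (P := @Etale) (Q := ⊤) f

instance {X Y : Scheme.{u}} (f : X ⟶ Y) : PreservesFiniteLimits (etalePullback f) := by
  have h : PreservesFiniteLimits (etalePullback f ⋙ Scheme.Etale.forget X) := by
    have : PreservesLimits (CategoryTheory.Over.pullback f) :=
      (CategoryTheory.Over.mapPullbackAdj f).rightAdjoint_preservesLimits
    exact preservesFiniteLimits_of_natIso (etalePullbackForget f).symm
  exact ⟨fun J _ _ ↦ preservesLimitsOfShape_of_reflects_of_preserves _ (Scheme.Etale.forget X)⟩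

instance {X Y : Scheme.{u}} (f : X ⟶ Y) :
    (etalePullback f).IsContinuous Y.smallEtaleTopology X.smallEtaleTopology := by
  have : RepresentablyFlat (etalePullback f) := flat_of_preservesFiniteLimits _
  rw [Functor.isContinuous_iff_coverPreserving]
  refine ⟨fun {T S} hS ↦ ?_⟩
  obtain ⟨ι, Z, g, rfl⟩ := S.exists_eq_ofArrows
  rw [Sieve.functorPushforward_ofArrows]
  rw [Scheme.ofArrows_mem_smallEtaleTopology_iff] at hS ⊢
  refine Set.eq_univ_of_forall fun x ↦ ?_
  let pr (T : Y.Etale) : ((etalePullback f).obj T).left ⟶ T.left := pullback.fst T.hom f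
  obtain ⟨i, z, hz⟩ := Set.mem_iUnion.1 (hS.symm ▸ Set.mem_univ (pr T x))
  have sq : IsPullback ((etalePullback f).map (g i)).left (pr (Z i)) (pr T) (g i).left := by
    have hc : pr (Z i) ≫ (g i).left = ((etalePullback f).map (g i)).left ≫ pr T :=
      (pullback.lift_fst _ _ _).symm
    refine (IsPullback.of_bot (v₂₁ := ((etalePullback f).obj T).hom) (v₂₂ := T.hom) (h₃₁ := f)
      ?_ hc (IsPullback.of_hasPullback T.hom f)).flip
    have h1 : ((etalePullback f).map (g i)).left ≫ ((etalePullback f).obj T).hom =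
      pullback.snd (Z i).hom f := pullback.lift_snd _ _ _
    have h2 : (g i).left ≫ T.hom = (Z i).hom := CategoryTheory.Over.w (g i).hom
    rw [h1, h2]
    exact IsPullback.of_hasPullback (Z i).hom f
  obtain ⟨w, hw, -⟩ := Scheme.exists_preimage_of_isPullback sq x z hz.symm
  exact Set.mem_iUnion.2 ⟨i, w, hw⟩

/-- The direct image functor `f_*` on sheaves of `R`-modules on small étale sites:
`(f_* F)(T) = F(T ×_Y X)`. -/
def pushforward {X Y : Scheme.{u}} (f : X ⟶ Y) (R : Type u) [CommRing R] :
    EtSheaf X R ⥤ EtSheaf Y R :=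
  (etalePullback f).sheafPushforwardContinuous (ModuleCat.{u} R)
    Y.smallEtaleTopology X.smallEtaleTopology

instance {X Y : Scheme.{u}} (f : X ⟶ Y) (R : Type u) [CommRing R] :
    (pushforward f R).Additive where

/-- The global sections functor `F ↦ F(X)`. -/
def globalSections (X : Scheme.{u}) (R : Type u) [CommRing R] :
    EtSheaf X R ⥤ ModuleCat.{u} R :=
  sheafToPresheaf _ _ ⋙ (evaluation _ _).obj (op (Scheme.Etale.mk (𝟙 X)))

instance (X : Scheme.{u}) (R : Type u) [CommRing R] : (globalSections X R).Additive where

/-- The higher direct image `R^i f_* F` on the small étale site. -/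
def higherDirectImage {X Y : Scheme.{u}} (f : X ⟶ Y) {R : Type u} [CommRing R] (i : ℕ)
    (F : EtSheaf X R) : EtSheaf Y R :=
  ((pushforward f R).rightDerived i).obj F

/-- Étale cohomology `H^i_ét(X, F)`, as an `R`-module. -/
def etaleCohomology (X : Scheme.{u}) {R : Type u} [CommRing R] (i : ℕ) (F : EtSheaf X R) :
    ModuleCat.{u} R :=
  ((globalSections X R).rightDerived i).obj F

/-- The canonical morphism `M_Y ⟶ f_* M_X` of constant sheaves. -/
def constToPushforward {X Y : Scheme.{u}} (f : X ⟶ Y) {R : Type u} [CommRing R]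
    (M : ModuleCat.{u} R) : constSheaf Y M ⟶ (pushforward f R).obj (constSheaf X M) :=
  ((sheafificationAdjunction Y.smallEtaleTopology (ModuleCat.{u} R)).homEquiv
      ((Functor.const _).obj M) ((pushforward f R).obj (constSheaf X M))).symm
    (Functor.whiskerLeft (etalePullback f).op
      (toSheafify X.smallEtaleTopology ((Functor.const X.Etaleᵒᵖ).obj M)))

/-! ## Stalks, the fundamental group and its action -/

section Monodromy

variable {U : Scheme.{u}} {K : Type u} [Field K] [IsSepClosed K] (a : Spec (.of K) ⟶ U)
  {R : Type u} [CommRing R]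

/-- The stalk `V_a` of an étale sheaf at a geometric point `a`. -/
def stalk (V : EtSheaf U R) : ModuleCat.{u} R :=
  (Scheme.pointSmallEtale a).sheafFiber.obj V

/-- The germ at the geometric point `t` of `T`, lying over `a`, of a section of `V` over `T`. -/
def germ (V : EtSheaf U R) (T : U.Etale) (t : (Scheme.pointSmallEtale a).fiber.obj T)
    (s : V.obj.obj (op T)) : stalk a V :=
  (Scheme.pointSmallEtale a).toPresheafFiber T t V.obj s

variable (U) in
/-- The category of finite étale `U`-schemes. -/
abbrev FinEt := ObjectProperty.FullSubcategory fun T : U.Etale ↦ IsFinite T.hom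

/-- The fibre functor `T ↦ Hom_U(Spec K, T)` from finite étale `U`-schemes to sets. -/
def fibreFunctor : FinEt U ⥤ Type u :=
  ObjectProperty.ι _ ⋙ (Scheme.pointSmallEtale a).fiber

/-- The fundamental group `π₁(U, a)`. -/
abbrev PiOne := Aut (fibreFunctor a)

/-- The restriction of the sheaf `V` to the étale `U`-scheme `T` is a constant sheaf with
value `M`. -/
def IsConstantOn (V : EtSheaf U R) (T : U.Etale) (M : ModuleCat.{u} R) : Prop :=
  Nonempty (V.over T ≅ (constSheaf U M).over T)

/-- `V` is a locally constant sheaf of free `R`-modules of rank `b`. -/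
def IsLocallyConstantFree (V : EtSheaf U R) (b : ℕ) : Prop :=
  ∀ x : U, ∃ T : U.Etale, x ∈ Set.range T.hom ∧
    IsConstantOn V T (ModuleCat.of R (Fin b → R))

/-- The graph of the action of `π₁(U, a)` on the stalk `V_a` of a locally constant sheaf `V`:
if `T` is a finite étale `U`-scheme over which `V` is constant, then `σ ∈ π₁(U, a)` maps
the germ at `t ∈ T(K)` of a section `s` of `V` over `T` to the germ of `s` at `σ t`. -/
def Monodromy (V : EtSheaf U R) (σ : PiOne a) (v w : stalk a V) : Prop :=
  ∃ (T : FinEt U) (t : (fibreFunctor a).obj T) (s : V.obj.obj (op T.obj)),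
    (∃ M, IsConstantOn V T.obj M) ∧
      germ a V T.obj t s = v ∧ germ a V T.obj (σ.hom.app T t) s = w

end Monodromy

/-! ## The action on the cohomology of a geometric fibre -/

section Family

variable {X U : Scheme.{u}} (f : X ⟶ U) {K : Type u} [Field K] [IsSepClosed K]
  (a : Spec (.of K) ⟶ U)

/-- The fibre `X_a` of `f : X ⟶ U` over the geometric point `a`. -/
abbrev geomFibre : Scheme.{u} := pullback f a

/-- The projection `X_a ⟶ X`. -/
abbrev geomFibreι : geomFibre f a ⟶ X := pullback.fst f a

/-- A geometric point `t` over `a` of an étale `U`-scheme `T` defines an `X`-morphism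
`X_a ⟶ X ×_U T`, hence a section over `X_a` of the base change of `X ×_U T` to `X_a`. -/
def fibreSection (T : U.Etale) (t : (Scheme.pointSmallEtale a).fiber.obj T) :
    Scheme.Etale.mk (𝟙 (geomFibre f a)) ⟶
      (etalePullback (geomFibreι f a)).obj ((etalePullback f).obj T) :=
  MorphismProperty.Over.homMk
    (pullback.lift
      (pullback.lift (pullback.snd f a ≫ t.left) (geomFibreι f a)
        ((Category.assoc _ _ _).trans
          ((congrArg (pullback.snd f a ≫ ·) (CategoryTheory.Over.w t)).trans
            pullback.condition.symm)))
      (𝟙 _) ((pullback.lift_snd _ _ _).trans (Category.id_comp _).symm))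
    (pullback.lift_snd _ _ _)

variable {R : Type u} [CommRing R] (M : ModuleCat.{u} R) (i : ℕ)

/-- The canonical base change isomorphism `(R^i f_* M)_a ≃ H^i(X_a, M)`. Let `I` and `J` be
injective resolutions of the constant sheaves `M` on `X` and on `X_a`, let `g : X_a ⟶ X` be the
projection, and let `φ : I ⟶ g_* J` be a morphism of complexes extending the canonical morphism
`M ⟶ g_* M`. The class in `(R^i f_* M)(T)` of a cocycle `z ∈ I^i(X ×_U T)` has a germ at a point
`t` of `T` over `a`; this germ is mapped to the class of the restriction of `φ(z)` to `X_a`. -/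
def IsBaseChangeIso
    (e : stalk a (higherDirectImage f i (constSheaf X M)) ≃ₗ[R]
      etaleCohomology (geomFibre f a) i (constSheaf (geomFibre f a) M)) : Prop :=
  ∃ (I : InjectiveResolution (constSheaf X M))
    (J : InjectiveResolution (constSheaf (geomFibre f a) M))
    (φ : I.cocomplex ⟶
      ((pushforward (geomFibreι f a) R).mapHomologicalComplex _).obj J.cocomplex),
    I.ι.f 0 ≫ φ.f 0 = constToPushforward (geomFibreι f a) M ≫
      (pushforward (geomFibreι f a) R).map (J.ι.f 0) ∧
    ∀ (T : U.Etale) (t : (Scheme.pointSmallEtale a).fiber.obj T)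
      (z : ((((pushforward f R).mapHomologicalComplex _).obj I.cocomplex).cycles i).obj.obj
        (op T))
      (z' : (((globalSections _ R).mapHomologicalComplex _).obj J.cocomplex).cycles i),
      (((globalSections _ R).mapHomologicalComplex _).obj J.cocomplex).iCycles i z' =
        (J.cocomplex.X i).obj.map (fibreSection f a T t).op
          ((φ.f i).hom.app (op ((etalePullback f).obj T))
            (((((pushforward f R).mapHomologicalComplex _).obj
              I.cocomplex).iCycles i).hom.app (op T) z)) →
      e (germ a _ T t ((I.isoRightDerivedObj (pushforward f R) i).inv.hom.app (op T)
          (((((pushforward f R).mapHomologicalComplex _).obj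
            I.cocomplex).homologyπ i).hom.app (op T) z))) =
        (J.isoRightDerivedObj (globalSections _ R) i).inv
          ((((globalSections _ R).mapHomologicalComplex _).obj J.cocomplex).homologyπ i z')

/-- The graph of the natural action of `π₁(U, a)` on `H^i(X_a, M)`: the action on the stalk
`(R^i f_* M)_a`, transported along the base change isomorphism `e` from `(R^i f_* M)_a` to `H^i(X_a, M)` (which is
unique, because the germs of classes of cocycles exhaust the stalk). -/
def CohomologyMonodromy (σ : PiOne a)
    (x y : etaleCohomology (geomFibre f a) i (constSheaf (geomFibre f a) M)) : Prop :=
  ∃ e, IsBaseChangeIso f a M i e ∧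
    Monodromy a (higherDirectImage f i (constSheaf X M)) σ (e.symm x) (e.symm y)

end Family

/-! ## The sheaf `P_n(V)` and the schemes `U_n` and `C_n` -/

section Proj

variable {U : Scheme.{u}} (ℓ n : ℕ) (V : EtSheaf U (Lam.{u} ℓ n))

/-- The sections over `T` of the sheaf of sets `V^*`: the sections `s` of `V` over `T` such that
`ℓ^(n-1) s` vanishes on no nonempty étale `T`-scheme. -/
def starSections (T : U.Etale) : SubMulAction (Lam.{u} ℓ n)ˣ (V.obj.obj (op T)) where
  carrier := {s | ∀ (T' : U.Etale) (g : T' ⟶ T), Nonempty T'.left →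
    V.obj.map g.op s ∈ starSet ℓ n (V.obj.obj (op T'))}
  smul_mem' c s hs T' g hT' := by
    have h : V.obj.map g.op (c • s) = c • V.obj.map g.op s :=
      (V.obj.map g.op).hom.map_smul (c : Lam.{u} ℓ n) s
    rw [h]
    exact (starSet ℓ n _).smul_mem c (hs T' g hT')

/-- The restriction map `V^*(T) → V^*(T')`. -/
def starSections.restrict {T T' : U.Etale} (g : T' ⟶ T) (s : starSections ℓ n V T) :
    starSections ℓ n V T' :=
  ⟨V.obj.map g.op s.1, fun T'' h hT'' ↦ by
    have e : V.obj.map h.op (V.obj.map g.op s.1) = V.obj.map (h ≫ g).op s.1 := by simp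
    rw [e]
    exact s.2 T'' (h ≫ g) hT''⟩

/-- The presheaf `T ↦ V^*(T) / Λ_n^*`. -/
def projPresheaf : U.Etaleᵒᵖ ⥤ Type u where
  obj T := MulAction.orbitRel.Quotient (Lam.{u} ℓ n)ˣ (starSections ℓ n V T.unop)
  map {T T'} g := TypeCat.ofHom (Quotient.map (starSections.restrict ℓ n V g.unop) (by
    rintro _ s ⟨c, rfl⟩
    exact ⟨c, Subtype.ext ((V.obj.map g).hom.map_smul (c : Lam.{u} ℓ n) s.1).symm⟩))
  map_id T := by
    ext x
    induction x using Quotient.inductionOn with | _ s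
    exact congrArg (Quotient.mk _) (Subtype.ext (by simp [starSections.restrict]))
  map_comp g h := by
    ext x
    induction x using Quotient.inductionOn with | _ s
    exact congrArg (Quotient.mk _) (Subtype.ext (by simp [starSections.restrict]))

/-- The sheaf `P_n(V)`, the quotient of the sheaf `V^*` by the action of `Λ_n^*`. -/
def projSheaf : Sheaf U.smallEtaleTopology (Type u) :=
  (presheafToSheaf _ _).obj (projPresheaf ℓ n V)

/-- The finite étale `U`-scheme `Un` represents the sheaf `P_n(V)`. -/
def RepresentsProj (Un : FinEt U) : Prop :=
  Nonempty (yoneda.obj Un.obj ≅ (projSheaf ℓ n V).obj)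

end Proj

/-! ## Curves -/

section Curves

variable {k : Type u} [Field k]

attribute [local instance] MvPolynomial.gradedAlgebra

/-- The morphism `π : U ⟶ Spec k` makes `U` a smooth (connected) curve over `k`. -/
structure IsSmoothCurve {U : Scheme.{u}} (π : U ⟶ Spec (.of k)) : Prop where
  smooth : SmoothOfRelativeDimension 1 π
  separated : IsSeparated π
  quasiCompact : QuasiCompact π
  connected : ConnectedSpace U

variable (k) in
/-- The projective space `ℙ^N` over `k`. -/
def projectiveSpace (N : ℕ) : Scheme.{u} :=
  AlgebraicGeometry.Proj (MvPolynomial.homogeneousSubmodule (Fin (N + 1)) k)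

variable (k) in
/-- The structure morphism of `ℙ^N`. -/
def projectiveSpaceToSpec (N : ℕ) : projectiveSpace k N ⟶ Spec (.of k) :=
  Proj.toSpecZero (MvPolynomial.homogeneousSubmodule (Fin (N + 1)) k) ≫
    Spec.map (CommRingCat.ofHom (algebraMap k
      (MvPolynomial.homogeneousSubmodule (Fin (N + 1)) k 0)))

/-- `C` is a projective `k`-scheme. -/
def IsProjectiveOver {C : Scheme.{u}} (p : C ⟶ Spec (.of k)) : Prop :=
  ∃ (N : ℕ) (i : C ⟶ projectiveSpace k N), IsClosedImmersion i ∧ i ≫ projectiveSpaceToSpec k N = p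

/-- `p : C ⟶ Spec k`, together with `j : Y ⟶ C`, is a regular projectivisation of the `k`-scheme
`Y`: `C` is a regular scheme, projective over `k`, and `j` is a dense open immersion over `k`. -/
structure IsRegularProjectivisation {Y C : Scheme.{u}} (q : Y ⟶ Spec (.of k))
    (p : C ⟶ Spec (.of k)) (j : Y ⟶ C) : Prop where
  comm : j ≫ p = q
  openImmersion : IsOpenImmersion j
  dominant : IsDominant j
  regular : ∀ x : C, IsRegularLocalRing (C.presheaf.stalk x)
  projective : IsProjectiveOver p

end Curves

end TowerCurves

end

open TowerCurves

noncomputable section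

namespace TowerCurves

/-! ## Étale neighbourhoods and covering sieves -/

section Covers

variable {U : Scheme.{u}}

/-! Connectedness of `C_n` follows from that of `U_n`, which is dense in it. For a finite étale
scheme Y over the connected U, every nonempty clopen subset of Y is again finite étale over U. Its
image in U is clopen, hence everything, so it has a geometric point over `a`; since its inclusion
into Y is a morphism of finite étale U-schemes, automorphisms of the fibre functor preserve its
geometric points. A nontrivial clopen decomposition of Y would thus prevent π₁ from acting
transitively on the geometric fibre of Y.

For Y representing P_n(V), transitivity on this fibre is transferred from P_n(V_a) by the relation
`Represents` between vectors of V_a and points of Y. Every point is represented by a vector of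
V_a^*, unit multiples represent the same point, and a vector determines its point. The relation is
equivariant (`Monodromy.exists_represents`): a section over T on which V is constant lies in V^* on
a clopen part of T, where it defines a morphism to Y, and π₁ acts naturally with respect to that
morphism.

In the case of a family, each instance of the action on cohomology comes with its own base change
isomorphism, so the transfer to the stalk needs `IsBaseChangeIso.unique`. Germs of classes of
cocycles exhaust the stalk. Two choices of resolutions and comparison map give homotopic maps into
g_* J', because this complex has injective terms. The latter holds since an injective sheaf is a
retract of a product of injective skyscrapers, and the direct image of a skyscraper is a skyscraper.
-/

lemma exists_mem_range_of_mem {T : U.Etale} {S : Sieve T}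
    (hS : S ∈ U.smallEtaleTopology T) (x : T.left) :
    ∃ (T₁ : U.Etale) (g : T₁ ⟶ T), S g ∧ x ∈ Set.range g.left := by
  obtain ⟨ι, Z, g, rfl⟩ := S.exists_eq_ofArrows
  rw [Scheme.ofArrows_mem_smallEtaleTopology_iff] at hS
  obtain ⟨i, hi⟩ := Set.mem_iUnion.1 (hS.symm ▸ Set.mem_univ x)
  exact ⟨Z i, g i, Sieve.ofArrows_mk _ _ i, hi⟩

lemma isOpen_range_left {T T' : U.Etale} (g : T' ⟶ T) : IsOpen (Set.range g.left) :=
  g.left.isOpenMap.isOpen_range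

/-- Two étale maps to `T` whose images meet have a common nonempty refinement. -/
lemma exists_common_refinement {T T₁ T₂ : U.Etale} (g₁ : T₁ ⟶ T) (g₂ : T₂ ⟶ T)
    {x : T.left} (h₁ : x ∈ Set.range g₁.left) (h₂ : x ∈ Set.range g₂.left) :
    ∃ (T₃ : U.Etale) (f₁ : T₃ ⟶ T₁) (f₂ : T₃ ⟶ T₂), Nonempty T₃.left ∧ f₁ ≫ g₁ = f₂ ≫ g₂ := by
  obtain ⟨y₁, rfl⟩ := h₁
  obtain ⟨y₂, h⟩ := h₂
  have sq : IsPullback (pullback.fst g₁ g₂).left (pullback.snd g₁ g₂).left g₁.left g₂.left :=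
    ((IsPullback.of_hasPullback g₁ g₂).map (Scheme.Etale.forget U)).map (Over.forget U)
  obtain ⟨w, -, -⟩ := Scheme.exists_preimage_of_isPullback sq y₁ y₂ h.symm
  exact ⟨_, pullback.fst g₁ g₂, pullback.snd g₁ g₂, ⟨w⟩, pullback.condition⟩

variable {R : Type u} [CommRing R]

/-- Locally, a section of a constant sheaf is either zero or vanishes nowhere. -/
lemma IsConstantOn.exists_cover {V : EtSheaf U R} {T : U.Etale} {M : ModuleCat.{u} R}
    (hV : IsConstantOn V T M) (s : V.obj.obj (op T)) (x : T.left) :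
    ∃ (T₁ : U.Etale) (g : T₁ ⟶ T), x ∈ Set.range g.left ∧
      (V.obj.map g.op s = 0 ∨ ∀ (T₂ : U.Etale) (h : T₂ ⟶ T₁), Nonempty T₂.left →
        V.obj.map (h ≫ g).op s ≠ 0) := by
  obtain ⟨e⟩ := hV
  let P : U.Etaleᵒᵖ ⥤ ModuleCat.{u} R := (Functor.const _).obj M
  let η : P ⟶ (constSheaf U M).obj := toSheafify U.smallEtaleTopology P
  have : Presheaf.IsLocallySurjective U.smallEtaleTopology η :=
    inferInstanceAs (Presheaf.IsLocallySurjective _ (toSheafify U.smallEtaleTopology P))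
  have : Presheaf.IsLocallyInjective U.smallEtaleTopology η :=
    inferInstanceAs (Presheaf.IsLocallyInjective _ (toSheafify U.smallEtaleTopology P))
  let E (T₁ : U.Etale) (g : T₁ ⟶ T) : V.obj.obj (op T₁) ⟶ (constSheaf U M).obj.obj (op T₁) :=
    e.hom.hom.app (op (Over.mk g))
  have hE (T₁ : U.Etale) (g : T₁ ⟶ T) : Function.Injective (E T₁ g) := by
    have : IsIso (E T₁ g) := by
      have : IsIso e.hom.hom := inferInstanceAs (IsIso ((sheafToPresheaf _ _).map e.hom))
      exact inferInstanceAs (IsIso (e.hom.hom.app (op (Over.mk g))))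
    exact ((ModuleCat.mono_iff_injective _).1 inferInstance)
  have nat (T₁ T₂ : U.Etale) (g : T₁ ⟶ T) (h : T₂ ⟶ T₁) (z : V.obj.obj (op T₁)) :
      E T₂ (h ≫ g) (V.obj.map h.op z) = (constSheaf U M).obj.map h.op (E T₁ g z) :=
    ConcreteCategory.congr_hom (e.hom.hom.naturality
      (Over.homMk h : Over.mk (h ≫ g) ⟶ Over.mk g).op) z
  let c := E T (𝟙 T) s
  -- Near `x` the section of the constant sheaf comes from a single element `m` of `M`; the
  -- dichotomy is whether `m` is zero.
  obtain ⟨T₁, g, ⟨m, hm⟩, hx⟩ := exists_mem_range_of_mem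
    (Presheaf.imageSieve_mem U.smallEtaleTopology η c) x
  refine ⟨T₁, g, hx, ?_⟩
  have hEg : E T₁ (g ≫ 𝟙 T) (V.obj.map g.op s) = η.app (op T₁) m :=
    (nat T T₁ (𝟙 T) g s).trans hm.symm
  by_cases hm0 : m = 0
  · left
    apply hE T₁ (g ≫ 𝟙 T)
    rw [hEg, hm0, map_zero, map_zero]
  -- If the section vanishes on a nonempty T₂, then `m` and 0 agree there after sheafification,
  -- hence already on some T₃ by local injectivity. The point `y` supplies such a T₃, and
  -- restriction in the constant presheaf is the identity, so `m` = 0.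
  · refine Or.inr fun T₂ h ⟨y⟩ h0 ↦ hm0 ?_
    have h1 : η.app (op T₂) (P.map h.op m) = η.app (op T₂) 0 := by
      have h2 := nat T₁ T₂ (g ≫ 𝟙 T) h (V.obj.map g.op s)
      have h3 : V.obj.map h.op (V.obj.map g.op s) = V.obj.map (h ≫ g).op s := by simp
      rw [h3, h0, map_zero, hEg] at h2
      rw [map_zero, h2]
      exact NatTrans.naturality_apply η h.op m
    obtain ⟨T₃, f, hf, -⟩ := exists_mem_range_of_mem
      (Presheaf.equalizerSieve_mem U.smallEtaleTopology η _ _ h1) y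
    have hf' : P.map f.op (P.map h.op m) = P.map f.op 0 := hf
    simpa [P] using hf'

end Covers

/-! ## Geometric points of étale schemes -/

section Points

variable {U : Scheme.{u}} {K : Type u} [Field K] [IsSepClosed K] (a : Spec (.of K) ⟶ U)

/-- The morphism `Spec K ⟶ T` given by a geometric point of `T` over `a`. -/
def pointHom {T : U.Etale} (t : (Scheme.pointSmallEtale a).fiber.obj T) :
    Spec (.of K) ⟶ T.left :=
  t.left

/-- Residue field extensions of an étale morphism are finite separable, so they embed into the
separably closed field `K`. -/
lemma exists_map_eq {T T' : U.Etale} (g : T' ⟶ T)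
    (t : (Scheme.pointSmallEtale a).fiber.obj T)
    (ht : pointHom a t default ∈ Set.range g.left) :
    ∃ t', (Scheme.pointSmallEtale a).fiber.map g t' = t := by
  obtain ⟨x, hx⟩ := ht
  obtain ⟨l, hl, -⟩ := Scheme.exists_fac_of_etale_of_isSepClosed g.left (pointHom a t) x hx
  have h1 : g.left ≫ T.hom = T'.hom := Over.w g.hom
  have h2 : pointHom a t ≫ T.hom = a := Over.w t
  have h3 : l ≫ T'.hom = a := by rw [← h1, reassoc_of% hl, h2]
  exact ⟨Over.homMk l h3, Over.OverMorphism.ext hl⟩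

/-- The open and closed subscheme of a finite étale `U`-scheme on a clopen set of points. -/
lemma exists_finEt_of_isClopen (T : FinEt U) {A : Set T.obj.left} (hA : IsClopen A) :
    ∃ (T' : FinEt U) (ι : T' ⟶ T), Set.range ι.hom.left = A := by
  let O : T.obj.left.Opens := ⟨A, hA.isOpen⟩
  have hr : Set.range O.ι = A := O.range_ι
  have : IsClosedImmersion O.ι :=
    IsClosedImmersion.of_isPreimmersion _ (hr ▸ hA.isClosed)
  have : Etale T.obj.hom := T.obj.prop
  have : IsFinite T.obj.hom := T.property
  exact ⟨⟨Scheme.Etale.mk (O.ι ≫ T.obj.hom),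
    inferInstanceAs (IsFinite (O.ι ≫ T.obj.hom))⟩,
    ObjectProperty.homMk (MorphismProperty.Over.homMk O.ι rfl), hr⟩

/-- A finite étale morphism is open and closed, so over a connected base a nonempty source forces
surjectivity. -/
lemma exists_geometricPoint [ConnectedSpace U] (T : FinEt U) (hT : Nonempty T.obj.left) :
    Nonempty ((fibreFunctor a).obj T) := by
  let f : T.obj.left ⟶ U := T.obj.hom
  have : Etale f := T.obj.prop
  have : IsFinite f := T.property
  have h : Set.range f = Set.univ :=
    IsClopen.eq_univ ⟨f.isClosedMap.isClosed_range, f.isOpenMap.isOpen_range⟩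
      (Set.range_nonempty _)
  obtain ⟨y, hy⟩ := h.symm ▸ Set.mem_univ (a default)
  exact ⟨(Scheme.pointSmallEtaleFiberObjToPreimage_surjective a rfl T.obj ⟨y, hy⟩).choose⟩

end Points

/-! ## Germs, and the points of a scheme representing `P_n(V)` -/

section Germs

variable {U : Scheme.{u}} {K : Type u} [Field K] [IsSepClosed K] (a : Spec (.of K) ⟶ U)

section

variable {R : Type u} [CommRing R] (V : EtSheaf U R)

lemma germ_map {T T' : U.Etale} (g : T' ⟶ T) (t : (Scheme.pointSmallEtale a).fiber.obj T')
    (s : V.obj.obj (op T)) :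
    germ a V T' t (V.obj.map g.op s) = germ a V T ((Scheme.pointSmallEtale a).fiber.map g t) s :=
  (Scheme.pointSmallEtale a).toPresheafFiber_w_apply g t V.obj s

lemma germ_smul {T : U.Etale} (t : (Scheme.pointSmallEtale a).fiber.obj T) (r : R)
    (s : V.obj.obj (op T)) : germ a V T t (r • s) = r • germ a V T t s :=
  ((Scheme.pointSmallEtale a).toPresheafFiber T t V.obj).hom.map_smul r s

lemma germ_nsmul {T : U.Etale} (t : (Scheme.pointSmallEtale a).fiber.obj T) (r : ℕ)
    (s : V.obj.obj (op T)) : germ a V T t (r • s) = r • germ a V T t s :=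
  map_nsmul ((Scheme.pointSmallEtale a).toPresheafFiber T t V.obj).hom r s

lemma germ_zero {T : U.Etale} (t : (Scheme.pointSmallEtale a).fiber.obj T) :
    germ a V T t 0 = 0 :=
  map_zero ((Scheme.pointSmallEtale a).toPresheafFiber T t V.obj).hom

lemma exists_germ_eq (v : stalk a V) : ∃ (T : U.Etale)
    (t : (Scheme.pointSmallEtale a).fiber.obj T) (s : V.obj.obj (op T)), germ a V T t s = v :=
  (Scheme.pointSmallEtale a).toPresheafFiber_jointly_surjective (A := ModuleCat.{u} R) v

/-- Two sections with the same germ agree on a common étale neighbourhood. -/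
lemma exists_map_eq_of_germ_eq {T₁ T₂ : U.Etale}
    {t₁ : (Scheme.pointSmallEtale a).fiber.obj T₁} {t₂ : (Scheme.pointSmallEtale a).fiber.obj T₂}
    {s₁ : V.obj.obj (op T₁)} {s₂ : V.obj.obj (op T₂)}
    (h : germ a V T₁ t₁ s₁ = germ a V T₂ t₂ s₂) :
    ∃ (T : U.Etale) (g₁ : T ⟶ T₁) (g₂ : T ⟶ T₂) (t : (Scheme.pointSmallEtale a).fiber.obj T),
      (Scheme.pointSmallEtale a).fiber.map g₁ t = t₁ ∧
      (Scheme.pointSmallEtale a).fiber.map g₂ t = t₂ ∧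
      V.obj.map g₁.op s₁ = V.obj.map g₂.op s₂ := by
  obtain ⟨T₃, t₃, p₁, p₂, rfl, rfl⟩ : ∃ (T₃ : U.Etale)
      (t₃ : (Scheme.pointSmallEtale a).fiber.obj T₃) (p₁ : T₃ ⟶ T₁) (p₂ : T₃ ⟶ T₂),
      (Scheme.pointSmallEtale a).fiber.map p₁ t₃ = t₁ ∧
      (Scheme.pointSmallEtale a).fiber.map p₂ t₃ = t₂ := by
    obtain ⟨c, p₁, p₂, -⟩ := IsCofilteredOrEmpty.cone_objs
      ((Scheme.pointSmallEtale a).fiber.elementsMk _ t₁)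
      ((Scheme.pointSmallEtale a).fiber.elementsMk _ t₂)
    exact ⟨c.1, c.2, p₁.1, p₂.1, p₁.2, p₂.2⟩
  rw [← germ_map, ← germ_map] at h
  obtain ⟨T, f, t, rfl, hf⟩ := ((Scheme.pointSmallEtale a).toPresheafFiber_eq_iff'
    (A := ModuleCat.{u} R) T₃ t₃ _ _).1 h
  refine ⟨T, f ≫ p₁, f ≫ p₂, t, by simp, by simp, ?_⟩
  simpa using hf

end

variable {ℓ n : ℕ} {V : EtSheaf U (Lam.{u} ℓ n)}

/-- The class in `P_n(V)` over `T` of a section of `V^*`. -/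
def projClass {T : U.Etale} (s : starSections ℓ n V T) : (projSheaf ℓ n V).obj.obj (op T) :=
  (toSheafify U.smallEtaleTopology (projPresheaf ℓ n V)).app (op T) (Quotient.mk _ s)

lemma projClass_restrict {T T' : U.Etale} (g : T' ⟶ T) (s : starSections ℓ n V T) :
    projClass (starSections.restrict ℓ n V g s) = (projSheaf ℓ n V).obj.map g.op (projClass s) :=
  NatTrans.naturality_apply (toSheafify U.smallEtaleTopology (projPresheaf ℓ n V)) g.op
    (Quotient.mk _ s)

lemma projClass_smul {T : U.Etale} (c : (Lam.{u} ℓ n)ˣ) (s : starSections ℓ n V T) :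
    projClass (c • s) = projClass s :=
  congrArg ((toSheafify U.smallEtaleTopology (projPresheaf ℓ n V)).app (op T))
    (Quotient.sound ⟨c, rfl⟩)

lemma exists_projClass_eq {T : U.Etale} (ξ : (projSheaf ℓ n V).obj.obj (op T))
    (t : (Scheme.pointSmallEtale a).fiber.obj T) :
    ∃ (T' : U.Etale) (g : T' ⟶ T) (t' : (Scheme.pointSmallEtale a).fiber.obj T')
      (s : starSections ℓ n V T'), (Scheme.pointSmallEtale a).fiber.map g t' = t ∧
      projClass s = (projSheaf ℓ n V).obj.map g.op ξ := by
  obtain ⟨T', g, ⟨m, hm⟩, t', ht'⟩ := (Scheme.pointSmallEtale a).jointly_surjective _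
    (Presheaf.imageSieve_mem U.smallEtaleTopology
      (toSheafify U.smallEtaleTopology (projPresheaf ℓ n V)) ξ) t
  obtain ⟨s, rfl⟩ := Quotient.exists_rep m
  exact ⟨T', g, t', s, ht', hm⟩

/-- A vanishing germ of ℓ^(n-1) s would make this section vanish on an étale neighbourhood of `t`,
which is nonempty because it carries a geometric point. -/
lemma germ_mem_starSet {T : U.Etale} (t : (Scheme.pointSmallEtale a).fiber.obj T)
    (s : starSections ℓ n V T) : germ a V T t s.1 ∈ starSet ℓ n (stalk a V) := by
  intro h
  rw [← germ_nsmul, ← germ_zero a V t] at h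
  obtain ⟨T', f, t', -, hf⟩ := ((Scheme.pointSmallEtale a).toPresheafFiber_eq_iff'
    (A := ModuleCat.{u} (Lam.{u} ℓ n)) T t _ _).1 h
  refine s.2 T' f ⟨pointHom a t' default⟩ ?_
  rw [map_zero] at hf
  rw [← hf]
  exact (map_nsmul (V.obj.map f.op).hom _ _).symm

variable {Y : U.Etale} (e : yoneda.obj Y ≅ (projSheaf ℓ n V).obj)

/-- The element `v` of `V_a` represents the geometric point `x` of the scheme `Y` which
represents `P_n(V)`. -/
def Represents (v : stalk a V) (x : (Scheme.pointSmallEtale a).fiber.obj Y) : Prop :=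
  ∃ (T : U.Etale) (g : T ⟶ Y) (t : (Scheme.pointSmallEtale a).fiber.obj T)
    (s : starSections ℓ n V T), (Scheme.pointSmallEtale a).fiber.map g t = x ∧
      projClass s = e.hom.app (op T) g ∧ germ a V T t s.1 = v

/-- The identity of `Y` corresponds to the universal section of P_n(V). It lifts to V^* on an étale
neighbourhood of `x`, and the germ of a lift is the required vector. -/
lemma exists_represents (x : (Scheme.pointSmallEtale a).fiber.obj Y) :
    ∃ v ∈ starSet ℓ n (stalk a V), Represents a e v x := by
  obtain ⟨T, g, t, s, ht, hs⟩ := exists_projClass_eq a (e.hom.app (op Y) (𝟙 Y)) x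
  refine ⟨germ a V T t s.1, germ_mem_starSet a t s, T, g, t, s, ht, hs.trans ?_, rfl⟩
  have h := NatTrans.naturality_apply e.hom g.op (𝟙 Y)
  have h' : (yoneda.obj Y).map g.op (𝟙 Y) = g := Category.comp_id g
  rw [← h, h']

variable {a e}

lemma Represents.smul {v : stalk a V} {x : (Scheme.pointSmallEtale a).fiber.obj Y}
    (h : Represents a e v x) (c : (Lam.{u} ℓ n)ˣ) : Represents a e (c • v) x := by
  obtain ⟨T, g, t, s, ht, hs, rfl⟩ := h
  exact ⟨T, g, t, c • s, ht, (projClass_smul c s).trans hs, germ_smul a V t (c : Lam ℓ n) s.1⟩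

/-- Sections with equal germs agree on a common neighbourhood, so their classes in P_n(V), and hence
the corresponding morphisms to `Y`, agree there. -/
lemma Represents.unique {v : stalk a V} {x y : (Scheme.pointSmallEtale a).fiber.obj Y}
    (hx : Represents a e v x) (hy : Represents a e v y) : x = y := by
  obtain ⟨T₁, g₁, t₁, s₁, rfl, hs₁, h₁⟩ := hx
  obtain ⟨T₂, g₂, t₂, s₂, rfl, hs₂, h₂⟩ := hy
  obtain ⟨T, f₁, f₂, t, rfl, rfl, h⟩ := exists_map_eq_of_germ_eq a V (h₁.trans h₂.symm)
  have key : f₁ ≫ g₁ = f₂ ≫ g₂ := by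
    have hinj : Function.Injective (e.hom.app (op T)) :=
      ((isIso_iff_bijective (e.hom.app (op T))).1 inferInstance).1
    apply hinj
    have n₁ : e.hom.app (op T) (f₁ ≫ g₁) = (projSheaf ℓ n V).obj.map f₁.op (e.hom.app (op T₁) g₁) :=
      NatTrans.naturality_apply e.hom f₁.op g₁
    have n₂ : e.hom.app (op T) (f₂ ≫ g₂) = (projSheaf ℓ n V).obj.map f₂.op (e.hom.app (op T₂) g₂) :=
      NatTrans.naturality_apply e.hom f₂.op g₂
    rw [n₁, n₂, ← hs₁, ← hs₂, ← projClass_restrict, ← projClass_restrict]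
    exact congrArg projClass (Subtype.ext h)
  have h' := congrArg (fun f ↦ (Scheme.pointSmallEtale a).fiber.map f t) key
  simpa using h'

/-- A section of `V^*` over `T` defines a morphism from `T` to the scheme representing `P_n(V)`,
whose values at geometric points are represented by the germs of the section. -/
lemma exists_hom_represents {T : U.Etale} (s : starSections ℓ n V T) :
    ∃ g : T ⟶ Y, ∀ t, Represents a e (germ a V T t s.1)
      ((Scheme.pointSmallEtale a).fiber.map g t) := by
  have hsurj : Function.Surjective (e.hom.app (op T)) :=
    ((isIso_iff_bijective (e.hom.app (op T))).1 inferInstance).2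
  obtain ⟨g, hg⟩ := hsurj (projClass s)
  exact ⟨g, fun t ↦ ⟨T, g, t, s, rfl, hg.symm, rfl⟩⟩

end Germs

/-! ## Transitivity and connectedness -/

section Transitive

variable {U : Scheme.{u}} {K : Type u} [Field K] [IsSepClosed K] (a : Spec (.of K) ⟶ U)
  {ℓ n : ℕ} {V : EtSheaf U (Lam.{u} ℓ n)}

/-- If `V` is constant on the finite étale `U`-scheme `T`, then a section `s` of `V` over `T`
belongs to `V^*` on an open and closed subscheme of `T`, which contains all geometric points
where the germ of `s` belongs to `V^*`. -/
lemma exists_starLocus {T : FinEt U} {M : ModuleCat.{u} (Lam.{u} ℓ n)}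
    (hV : IsConstantOn V T.obj M) (s : V.obj.obj (op T.obj)) :
    ∃ (T' : FinEt U) (ι : T' ⟶ T) (s' : starSections ℓ n V T'.obj),
      s'.1 = V.obj.map ι.hom.op s ∧
      ∀ t : (fibreFunctor a).obj T, germ a V T.obj t s ∈ starSet ℓ n (stalk a V) →
        ∃ t', (fibreFunctor a).map ι t' = t := by
  let r : V.obj.obj (op T.obj) := ℓ ^ (n - 1) • s
  -- `A` is the locus where `r` is locally nowhere zero, `B` the locus where it is locally zero.
  -- Both are open, and constancy of `V` makes them complementary, so `A` is clopen.
  let A : Set T.obj.left := {x | ∃ (T₁ : U.Etale) (g : T₁ ⟶ T.obj), x ∈ Set.range g.left ∧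
    ∀ (T₂ : U.Etale) (h : T₂ ⟶ T₁), Nonempty T₂.left → V.obj.map (h ≫ g).op r ≠ 0}
  let B : Set T.obj.left := {x | ∃ (T₁ : U.Etale) (g : T₁ ⟶ T.obj), x ∈ Set.range g.left ∧
    V.obj.map g.op r = 0}
  have hA : IsOpen A := isOpen_iff_forall_mem_open.2 fun x ⟨T₁, g, hx, hg⟩ ↦
    ⟨_, fun y hy ↦ ⟨T₁, g, hy, hg⟩, isOpen_range_left g, hx⟩
  have hB : IsOpen B := isOpen_iff_forall_mem_open.2 fun x ⟨T₁, g, hx, hg⟩ ↦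
    ⟨_, fun y hy ↦ ⟨T₁, g, hy, hg⟩, isOpen_range_left g, hx⟩
  have hd : ∀ x ∈ A, x ∉ B := by
    rintro x ⟨T₁, g₁, hx₁, h₁⟩ ⟨T₂, g₂, hx₂, h₂⟩
    obtain ⟨T₃, f₁, f₂, hT₃, hf⟩ := exists_common_refinement g₁ g₂ hx₁ hx₂
    refine h₁ T₃ f₁ hT₃ ?_
    rw [hf, op_comp, V.obj.map_comp, ModuleCat.comp_apply, h₂, map_zero]
  have hc : ∀ x, x ∉ A → x ∈ B := by
    intro x hx
    obtain ⟨T₁, g, hxg, h | h⟩ := hV.exists_cover r x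
    · exact ⟨T₁, g, hxg, h⟩
    · exact absurd ⟨T₁, g, hxg, h⟩ hx
  have hAB : Aᶜ = B := Set.ext fun x ↦ ⟨hc x, fun hx h ↦ hd x h hx⟩
  obtain ⟨T', ι, hι⟩ := exists_finEt_of_isClopen T (A := A) ⟨⟨hAB ▸ hB⟩, hA⟩
  have hs : V.obj.map ι.hom.op s ∈ starSections ℓ n V T'.obj := by
    intro T₂ g ⟨y⟩ h
    have hy : ι.hom.left (g.left y) ∈ A := hι ▸ Set.mem_range_self _
    refine hd _ hy ⟨T₂, g ≫ ι.hom, ⟨y, rfl⟩, ?_⟩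
    rw [op_comp, V.obj.map_comp, ModuleCat.comp_apply]
    exact (congrArg _ (map_nsmul (V.obj.map ι.hom.op).hom _ s)).trans
      ((map_nsmul (V.obj.map g.op).hom _ _).trans h)
  refine ⟨T', ι, ⟨_, hs⟩, rfl, fun t ht ↦ ?_⟩
  apply exists_map_eq a ι.hom t
  rw [hι]
  -- At a point of `B` the germ of `r` would be zero, against `ht`.
  by_contra hx
  obtain ⟨T₁, g, hxg, h⟩ := hc _ hx
  obtain ⟨t₁, rfl⟩ := exists_map_eq a g t hxg
  apply ht
  rw [← germ_nsmul, ← germ_map]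
  exact (congrArg _ h).trans (germ_zero a V t₁)

lemma fibreFunctor_naturality (σ : PiOne a) {T T' : FinEt U} (g : T' ⟶ T)
    (t : (fibreFunctor a).obj T') :
    σ.hom.app T ((fibreFunctor a).map g t) = (fibreFunctor a).map g (σ.hom.app T' t) :=
  NatTrans.naturality_apply σ.hom g t

variable {Y : FinEt U} (e : yoneda.obj Y.obj ≅ (projSheaf ℓ n V).obj)

/-- The action of `π₁(U, a)` on `P_n(V_a)` is compatible with its action on the geometric points
of the scheme that represents `P_n(V)`. -/
lemma Monodromy.exists_represents {σ : PiOne a} {v w : stalk a V} (h : Monodromy a V σ v w)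
    (hv : v ∈ starSet ℓ n (stalk a V)) :
    ∃ x : (fibreFunctor a).obj Y, Represents a e v x ∧ Represents a e w (σ.hom.app Y x) := by
  obtain ⟨T, t, s, ⟨M, hM⟩, rfl, rfl⟩ := h
  obtain ⟨T', ι, s', hs', ht⟩ := exists_starLocus a hM s
  obtain ⟨t', rfl⟩ := ht t hv
  obtain ⟨g, hg⟩ := exists_hom_represents (a := a) (e := e) s'
  have hgerm (z : (fibreFunctor a).obj T') :
      germ a V T'.obj z s'.1 = germ a V T.obj ((fibreFunctor a).map ι z) s := by
    rw [hs']
    exact germ_map a V ι.hom z s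
  let g' : T' ⟶ Y := ObjectProperty.homMk g
  refine ⟨(fibreFunctor a).map g' t', ?_, ?_⟩
  · rw [← hgerm]
    exact hg t'
  · rw [fibreFunctor_naturality, fibreFunctor_naturality, ← hgerm]
    exact hg (σ.hom.app T' t')

variable {a}

/-- If the action of `π₁(U, a)` on `P_n(V_a)` is transitive, then the scheme that represents
`P_n(V)` is connected. -/
theorem TransitiveOnProj.connectedSpace [ConnectedSpace U] (hY : RepresentsProj ℓ n V Y)
    (h : TransitiveOnProj ℓ n (stalk a V) (Monodromy a V)) : ConnectedSpace Y.obj.left := by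
  obtain ⟨e⟩ := hY
  have hne : Nonempty Y.obj.left := by
    obtain ⟨⟨P⟩, hP⟩ := h
    -- A point of `Y` is attached to a vector through the graph of the action, so transitivity is
    -- applied to the pair (P, P) merely to obtain one.
    obtain ⟨σ, v, w, -, -, hσ⟩ := hP P P
    obtain ⟨x, -⟩ := hσ.exists_represents a e v.2
    exact ⟨pointHom a x default⟩
  have trans (x y : (fibreFunctor a).obj Y) : ∃ σ : PiOne a, σ.hom.app Y x = y := by
    obtain ⟨v, hv, hvx⟩ := exists_represents a e x
    obtain ⟨w, hw, hwy⟩ := exists_represents a e y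
    obtain ⟨σ, v', w', hv', hw', hσ⟩ := h.2 (.mk ℓ n ⟨v, hv⟩) (.mk ℓ n ⟨w, hw⟩)
    obtain ⟨c, rfl⟩ := Quotient.exact hv'
    obtain ⟨d, rfl⟩ := Quotient.exact hw'
    obtain ⟨x', hx', hy'⟩ := hσ.exists_represents a e (Subtype.property _)
    exact ⟨σ, (congrArg _ ((hvx.smul c).unique hx')).trans (hy'.unique (hwy.smul d))⟩
  have point {A : Set Y.obj.left} (hA : IsClopen A) (hA' : A.Nonempty) :
      ∃ x : (fibreFunctor a).obj Y, ∀ σ : PiOne a, pointHom a (σ.hom.app Y x) default ∈ A := by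
    obtain ⟨T, ι, rfl⟩ := exists_finEt_of_isClopen Y hA
    obtain ⟨_, y, -⟩ := hA'
    obtain ⟨t⟩ := exists_geometricPoint a T ⟨y⟩
    refine ⟨(fibreFunctor a).map ι t, fun σ ↦ ?_⟩
    rw [fibreFunctor_naturality]
    exact ⟨pointHom a (σ.hom.app T t) default, rfl⟩
  have : PreconnectedSpace Y.obj.left := by
    rw [preconnectedSpace_iff_clopen]
    intro A hA
    by_contra! hA'
    obtain ⟨x, hx⟩ := point hA hA'.1
    obtain ⟨y, hy⟩ := point hA.compl (Set.nonempty_compl.2 hA'.2)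
    obtain ⟨σ, rfl⟩ := trans x y
    -- The orbit of `x` stays in `A`, that of σx in the complement; the identity automorphism shows
    -- σx in both.
    refine hy (Iso.refl _) (hx σ)
  exact { toNonempty := hne }

end Transitive

/-! ## Maps from an injective resolution to a complex of injective objects -/

section Homotopy

variable {C : Type*} [Category* C] [Abelian C] {Z : C}

/-- A morphism from an injective resolution of `Z` to a complex of injective objects which
vanishes on `Z` is homotopic to zero. -/
def homotopyZeroOfInjective (I : InjectiveResolution Z) {L : CochainComplex C ℕ}
    [∀ n, Injective (L.X n)] (f : I.cocomplex ⟶ L) (comm : I.ι.f 0 ≫ f.f 0 = 0) :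
    Homotopy f 0 :=
  -- Exactness is used for `I` only and injectivity for `L` only: `L` will be the direct image of a
  -- resolution, which need not be exact.
  let h₀ : I.cocomplex.X 1 ⟶ L.X 0 := I.exact₀.descToInjective (f.f 0) comm
  have e₀ : I.cocomplex.d 0 1 ≫ h₀ = f.f 0 := I.exact₀.comp_descToInjective _ _
  let h₁ : I.cocomplex.X 2 ⟶ L.X 1 := (I.exact_succ 0).descToInjective (f.f 1 - h₀ ≫ L.d 0 1)
    (by dsimp; rw [Preadditive.comp_sub, reassoc_of% e₀, HomologicalComplex.Hom.comm, sub_self])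
  have e₁ : I.cocomplex.d 1 2 ≫ h₁ = f.f 1 - h₀ ≫ L.d 0 1 :=
    (I.exact_succ 0).comp_descToInjective _ _
  Homotopy.mkCoinductive _ h₀ (by simp [e₀]) h₁ (by simp [e₁]) fun n ⟨g, g', w⟩ ↦
    ⟨(I.exact_succ (n + 1)).descToInjective (f.f (n + 2) - g' ≫ L.d _ _) (by
      dsimp
      rw [Preadditive.comp_sub, ← HomologicalComplex.Hom.comm, w, Preadditive.add_comp,
        Category.assoc, Category.assoc, HomologicalComplex.d_comp_d, comp_zero,
        zero_add, sub_self]), by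
      have := (I.exact_succ (n + 1)).comp_descToInjective (f.f (n + 2) - g' ≫ L.d _ _) (by
        dsimp
        rw [Preadditive.comp_sub, ← HomologicalComplex.Hom.comm, w, Preadditive.add_comp,
          Category.assoc, Category.assoc, HomologicalComplex.d_comp_d, comp_zero,
          zero_add, sub_self])
      dsimp at this
      rw [this]
      simp⟩

/-- Two morphisms from an injective resolution of `Z` to a complex of injective objects which
agree on `Z` are homotopic. -/
def homotopyOfInjective (I : InjectiveResolution Z) {L : CochainComplex C ℕ}
    [∀ n, Injective (L.X n)] (f g : I.cocomplex ⟶ L)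
    (comm : I.ι.f 0 ≫ f.f 0 = I.ι.f 0 ≫ g.f 0) : Homotopy f g :=
  Homotopy.equivSubZero.invFun (homotopyZeroOfInjective I (f - g) (by
    rw [HomologicalComplex.sub_f_apply, Preadditive.comp_sub, comm, sub_self]))

lemma epi_homologyπ_isoRightDerivedObj_inv [HasInjectiveResolutions C] {D : Type*} [Category* D]
    [Abelian D] (I : InjectiveResolution Z) (F : C ⥤ D) [F.Additive] (i : ℕ) :
    Epi (((F.mapHomologicalComplex _).obj I.cocomplex).homologyπ i ≫
      (I.isoRightDerivedObj F i).inv) :=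
  epi_comp' inferInstance (inferInstanceAs (Epi (I.isoRightDerivedObj F i).inv))

/-- The class of a cocycle in a right derived functor does not depend on the resolution. -/
lemma homologyπ_isoRightDerivedObj_inv [HasInjectiveResolutions C] {D : Type*} [Category* D]
    [Abelian D] (I I' : InjectiveResolution Z) (α : I.cocomplex ⟶ I'.cocomplex)
    (comm : I.ι.f 0 ≫ α.f 0 = 𝟙 Z ≫ I'.ι.f 0) (F : C ⥤ D) [F.Additive] (i : ℕ) :
    ((F.mapHomologicalComplex _).obj I.cocomplex).homologyπ i ≫ (I.isoRightDerivedObj F i).inv =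
      HomologicalComplex.cyclesMap ((F.mapHomologicalComplex _).map α) i ≫
        ((F.mapHomologicalComplex _).obj I'.cocomplex).homologyπ i ≫
          (I'.isoRightDerivedObj F i).inv := by
  have h := InjectiveResolution.isoRightDerivedObj_inv_naturality (𝟙 Z) I I' α comm F i
  rw [CategoryTheory.Functor.map_id, Category.comp_id] at h
  rw [h]
  exact HomologicalComplex.homologyπ_naturality_assoc _ _ _

end Homotopy

/-! ## The direct image functor preserves injective sheaves -/

section Pushforward

variable {X Y : Scheme.{u}} (g : X ⟶ Y) {R : Type u} [CommRing R]

/-- Geometric points of `T ×_Y X` over `b` are geometric points of `T` over `b ≫ g`. -/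
def fiberPullbackIso {K : Type u} [Field K] [IsSepClosed K] (b : Spec (.of K) ⟶ X) :
    etalePullback g ⋙ (Scheme.pointSmallEtale b).fiber ≅ (Scheme.pointSmallEtale (b ≫ g)).fiber :=
  let α : CategoryTheory.Over.pullback g ⋙ coyoneda.obj (op (Over.mk b)) ≅
      coyoneda.obj (op (Over.mk (b ≫ g))) :=
    NatIso.ofComponents (fun T ↦
      ((CategoryTheory.Over.mapPullbackAdj g).homEquiv (Over.mk b) T).symm.toIso) (by
        intro T T' h
        ext t
        exact (CategoryTheory.Over.mapPullbackAdj g).homEquiv_naturality_right_symm t h)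
  Functor.isoWhiskerRight (etalePullbackForget g) (coyoneda.obj (op (Over.mk b))) ≪≫
    Functor.isoWhiskerLeft (Scheme.Etale.forget Y) α

/-- The direct image of a skyscraper sheaf is a skyscraper sheaf. -/
def pushforwardSkyscraperIso {K : Type u} [Field K] [IsSepClosed K] (b : Spec (.of K) ⟶ X)
    (E : ModuleCat.{u} R) :
    (pushforward g R).obj ((Scheme.pointSmallEtale b).skyscraperSheaf E) ≅
      (Scheme.pointSmallEtale (b ≫ g)).skyscraperSheaf E :=
  let β : ((etalePullback g).op ⋙ (Scheme.pointSmallEtale b).fiber.op) ⋙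
      (piFunctor.{u} (C := ModuleCat.{u} R)).flip ≅
      (Scheme.pointSmallEtale (b ≫ g)).fiber.op ⋙ piFunctor.{u}.flip :=
    Functor.isoWhiskerRight (NatIso.op (fiberPullbackIso g b)).symm _
  (fullyFaithfulSheafToPresheaf _ _).preimageIso
    (((flipFunctor _ _ _).mapIso β).app E)

/-- The skyscraper functor is right adjoint to the stalk functor, which preserves monomorphisms. -/
lemma injective_skyscraperSheaf {K : Type u} [Field K] [IsSepClosed K] (b : Spec (.of K) ⟶ X)
    (E : ModuleCat.{u} R) [Injective E] :
    Injective ((Scheme.pointSmallEtale b).skyscraperSheaf E) :=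
  Injective.injective_of_adjoint (Scheme.pointSmallEtale b).skyscraperSheafAdjunction E

/-- Limits of sheaves are computed on sections, and the direct image only reindexes sections. -/
instance : PreservesLimitsOfSize.{u, u} (pushforward g R) := by
  have : PreservesLimitsOfSize.{u, u} (pushforward g R ⋙ sheafToPresheaf _ _) :=
    inferInstanceAs (PreservesLimitsOfSize.{u, u} (sheafToPresheaf _ _ ⋙
      (Functor.whiskeringLeft _ _ (ModuleCat.{u} R)).obj (etalePullback g).op))
  exact preservesLimits_of_reflects_of_preserves _ (sheafToPresheaf _ _)

/-- Every étale sheaf of modules embeds into a product of injective skyscraper sheaves. -/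
lemma exists_mono_pi_skyscraperSheaf (F : EtSheaf X R) :
    ∃ (ι : Type u) (G : ι → EtSheaf X R) (m : F ⟶ ∏ᶜ G), Mono m ∧
      ∀ i, Injective ((pushforward g R).obj (G i)) := by
  let b (x : X) : Spec (.of (SeparableClosure (X.residueField x))) ⟶ X :=
    (Scheme.SpecToEquivOfField (SeparableClosure (X.residueField x)) _).2
      ⟨x, CommRingCat.ofHom (algebraMap (X.residueField x) _)⟩
  let E (x : X) : ModuleCat.{u} R :=
    Injective.under ((Scheme.pointSmallEtale (b x)).sheafFiber.obj F)
  let G (x : X) : EtSheaf X R := (Scheme.pointSmallEtale (b x)).skyscraperSheaf (E x)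
  let φ (x : X) : F ⟶ G x :=
    (Scheme.pointSmallEtale (b x)).skyscraperSheafAdjunction.homEquiv F (E x) (Injective.ι _)
  refine ⟨X, G, Pi.lift φ, ?_, fun x ↦ ?_⟩
  · rw [((Scheme.isConservativeFamilyOfPoints_pointSmallEtale' X).jointlyReflectMonomorphisms
      (ModuleCat.{u} R)).mono_iff]
    rintro ⟨_, ⟨x⟩⟩
    -- Injectivity is tested on stalks. At `b x` the component `φ x` is adjoint to the embedding of
    -- the stalk into an injective module, so the stalk map is the first factor of a monomorphism.
    have h : (Scheme.pointSmallEtale (b x)).sheafFiber.map (Pi.lift φ) ≫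
        (Scheme.pointSmallEtale (b x)).sheafFiber.map (Pi.π G x) ≫
          (Scheme.pointSmallEtale (b x)).skyscraperSheafAdjunction.counit.app (E x) =
        Injective.ι _ := by
      rw [← Functor.map_comp_assoc, Pi.lift_π]
      exact ((Scheme.pointSmallEtale (b x)).skyscraperSheafAdjunction.homEquiv_counit ..).symm.trans
        (Equiv.symm_apply_apply _ _)
    exact mono_of_mono_fac h
  · have := injective_skyscraperSheaf (b x ≫ g) (E x)
    exact Injective.of_iso (pushforwardSkyscraperIso g (b x) (E x)).symm this

/-- The direct image functor preserves injective sheaves. -/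
instance injective_pushforward (F : EtSheaf X R) [Injective F] :
    Injective ((pushforward g R).obj F) := by
  obtain ⟨ι, G, m, hm, hG⟩ := exists_mono_pi_skyscraperSheaf g F
  have hP : Injective ((pushforward g R).obj (∏ᶜ G)) :=
    Injective.of_iso (PreservesProduct.iso (pushforward g R) G).symm inferInstance
  -- As `F` is injective, `m` splits, so the direct image of `F` is a retract of an injective sheaf.
  have hr : (pushforward g R).map m ≫
      (pushforward g R).map (Injective.factorThru (𝟙 F) m) = 𝟙 _ := by
    rw [← Functor.map_comp, Injective.comp_factorThru, CategoryTheory.Functor.map_id]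
  refine ⟨fun f i _ ↦ ⟨Injective.factorThru (f ≫ (pushforward g R).map m) i ≫
    (pushforward g R).map (Injective.factorThru (𝟙 F) m), ?_⟩⟩
  rw [Injective.comp_factorThru_assoc, Category.assoc, hr, Category.comp_id]

instance (J : CochainComplex (EtSheaf X R) ℕ) [∀ n, Injective (J.X n)] (n : ℕ) :
    Injective ((((pushforward g R).mapHomologicalComplex _).obj J).X n) :=
  injective_pushforward g (J.X n)

end Pushforward

/-! ## Uniqueness of the base change isomorphism -/

section BaseChange

variable {X U : Scheme.{u}} (f : X ⟶ U) {K : Type u} [Field K] [IsSepClosed K]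
  (a : Spec (.of K) ⟶ U) {R : Type u} [CommRing R] (i : ℕ)

section

section

variable {C : Type*} [Category* C] {A B B' D D' E E' : C}

/-- This identity and the next two are stated for bare morphisms, so that they apply to sections of
direct images by definitional unfolding. -/
lemma comp_comp_comp_of_square {c : A ⟶ B} {p : B ⟶ D} {r : D ⟶ E} {d : E ⟶ E'} {d' : D ⟶ D'}
    {r' : D' ⟶ E'} (h : r ≫ d = d' ≫ r') : (c ≫ p ≫ r) ≫ d = c ≫ (p ≫ d') ≫ r' := by
  simp [h]

variable [Preadditive C]

lemma comp_comp_eq_zero {c : A ⟶ B} {x : B ⟶ D} {r : D ⟶ E} {q : B ⟶ B'} {s : B' ⟶ D}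
    (hx : x = q ≫ s) (hc : c ≫ q = 0) : c ≫ x ≫ r = 0 := by
  rw [hx, Category.assoc, reassoc_of% hc, zero_comp]

lemma comp_comp_eq_add {c : A ⟶ B} {x y w : B ⟶ D} {r : D ⟶ E} {q : B ⟶ B'} {s : B' ⟶ D}
    (hx : x = q ≫ s + y + w) (hc : c ≫ q = 0) : c ≫ x ≫ r = c ≫ y ≫ r + c ≫ w ≫ r := by
  simp [hx, reassoc_of% hc]

end

variable {I I' : CochainComplex (EtSheaf X R) ℕ}
  {J J' : CochainComplex (EtSheaf (geomFibre f a) R) ℕ}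
  {T : U.Etale} (t : (Scheme.pointSmallEtale a).fiber.obj T)

/-- The restriction of a section of a direct image along `X_a ⟶ X` over `X ×_U T` to `X_a`. -/
def restrictToFibre (G : EtSheaf (geomFibre f a) R) :
    ((pushforward (geomFibreι f a) R).obj G).obj.obj (op ((etalePullback f).obj T)) ⟶
      (globalSections (geomFibre f a) R).obj G :=
  G.obj.map (fibreSection f a T t).op

lemma restrictToFibre_naturality {G G' : EtSheaf (geomFibre f a) R} (β : G ⟶ G') :
    restrictToFibre f a t G ≫ (globalSections (geomFibre f a) R).map β =
      ((pushforward (geomFibreι f a) R).map β).hom.app (op ((etalePullback f).obj T)) ≫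
        restrictToFibre f a t G' :=
  β.hom.naturality (fibreSection f a T t).op

/-- The sections over `T` of the sheaf of cocycles of `f_* I`, mapped to `X_a`. -/
def fibreCochain
    (φ : I ⟶ ((pushforward (geomFibreι f a) R).mapHomologicalComplex _).obj J) :
    ((((pushforward f R).mapHomologicalComplex _).obj I).cycles i).obj.obj (op T) ⟶
      (((globalSections _ R).mapHomologicalComplex _).obj J).X i :=
  ((((pushforward f R).mapHomologicalComplex _).obj I).iCycles i).hom.app (op T) ≫
    (φ.f i).hom.app (op ((etalePullback f).obj T)) ≫ restrictToFibre f a t (J.X i)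

lemma iCycles_app_d (j : ℕ) :
    ((((pushforward f R).mapHomologicalComplex _).obj I).iCycles i).hom.app (op T) ≫
      (I.d i j).hom.app (op ((etalePullback f).obj T)) = 0 :=
  congrArg (fun p ↦ p.hom.app (op T))
    ((((pushforward f R).mapHomologicalComplex _).obj I).iCycles_d i j)

lemma fibreCochain_d
    (φ : I ⟶ ((pushforward (geomFibreι f a) R).mapHomologicalComplex _).obj J) (j : ℕ) :
    fibreCochain f a i t φ ≫ (((globalSections _ R).mapHomologicalComplex _).obj J).d i j = 0 := by
  have h1 := restrictToFibre_naturality f a t (J.d i j)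
  have h2 : (φ.f i).hom.app (op ((etalePullback f).obj T)) ≫
      ((pushforward (geomFibreι f a) R).map (J.d i j)).hom.app _ =
      (I.d i j).hom.app (op ((etalePullback f).obj T)) ≫ (φ.f j).hom.app _ :=
    congrArg (fun p ↦ p.hom.app (op ((etalePullback f).obj T))) (φ.comm i j)
  exact (comp_comp_comp_of_square h1).trans (comp_comp_eq_zero h2 (iCycles_app_d f i j))

/-- The sections over `T` of the sheaf of cocycles of `f_* I`, mapped to cocycles on `X_a`. -/
def fibreCocycle
    (φ : I ⟶ ((pushforward (geomFibreι f a) R).mapHomologicalComplex _).obj J) :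
    ((((pushforward f R).mapHomologicalComplex _).obj I).cycles i).obj.obj (op T) ⟶
      (((globalSections _ R).mapHomologicalComplex _).obj J).cycles i :=
  HomologicalComplex.liftCycles _ (fibreCochain f a i t φ) _ rfl (fibreCochain_d f a i t φ _)

lemma fibreCocycle_iCycles
    (φ : I ⟶ ((pushforward (geomFibreι f a) R).mapHomologicalComplex _).obj J) :
    fibreCocycle f a i t φ ≫ (((globalSections _ R).mapHomologicalComplex _).obj J).iCycles i =
      fibreCochain f a i t φ :=
  HomologicalComplex.liftCycles_i _ _ _ _ _

lemma fibreCocycle_comp_cyclesMap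
    (φ : I ⟶ ((pushforward (geomFibreι f a) R).mapHomologicalComplex _).obj J) (β : J ⟶ J') :
    fibreCocycle f a i t φ ≫ HomologicalComplex.cyclesMap
        (((globalSections _ R).mapHomologicalComplex _).map β) i =
      fibreCocycle f a i t
        (φ ≫ ((pushforward (geomFibreι f a) R).mapHomologicalComplex _).map β) := by
  rw [← cancel_mono (HomologicalComplex.iCycles _ _), Category.assoc,
    HomologicalComplex.cyclesMap_i, fibreCocycle_iCycles, reassoc_of% fibreCocycle_iCycles]
  exact comp_comp_comp_of_square (restrictToFibre_naturality f a t (β.f i))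

lemma cyclesMap_comp_fibreCocycle (α : I' ⟶ I)
    (φ : I ⟶ ((pushforward (geomFibreι f a) R).mapHomologicalComplex _).obj J) :
    (HomologicalComplex.cyclesMap
        (((pushforward f R).mapHomologicalComplex _).map α) i).hom.app (op T) ≫
      fibreCocycle f a i t φ = fibreCocycle f a i t (α ≫ φ) := by
  rw [← cancel_mono (HomologicalComplex.iCycles _ _), Category.assoc, fibreCocycle_iCycles,
    fibreCocycle_iCycles]
  have h : (HomologicalComplex.cyclesMap
        (((pushforward f R).mapHomologicalComplex _).map α) i).hom.app (op T) ≫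
      ((((pushforward f R).mapHomologicalComplex _).obj I).iCycles i).hom.app (op T) =
      ((((pushforward f R).mapHomologicalComplex _).obj I').iCycles i).hom.app (op T) ≫
        (α.f i).hom.app (op ((etalePullback f).obj T)) :=
    congrArg (fun p ↦ p.hom.app (op T)) (HomologicalComplex.cyclesMap_i
      (((pushforward f R).mapHomologicalComplex _).map α) i)
  rw [fibreCochain, reassoc_of% h]
  rfl

lemma fibreCocycle_homologyπ_eq_of_homotopy
    {φ ψ : I ⟶ ((pushforward (geomFibreι f a) R).mapHomologicalComplex _).obj J}
    (h : Homotopy φ ψ) :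
    fibreCocycle f a i t φ ≫
        (((globalSections _ R).mapHomologicalComplex _).obj J).homologyπ i =
      fibreCocycle f a i t ψ ≫
        (((globalSections _ R).mapHomologicalComplex _).obj J).homologyπ i := by
  let p := (ComplexShape.up ℕ).prev i
  let y : ((((pushforward f R).mapHomologicalComplex _).obj I).cycles i).obj.obj (op T) ⟶
      (((globalSections _ R).mapHomologicalComplex _).obj J).X p :=
    ((((pushforward f R).mapHomologicalComplex _).obj I).iCycles i).hom.app (op T) ≫
      (h.hom i p).hom.app (op ((etalePullback f).obj T)) ≫ restrictToFibre f a t (J.X p)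
  -- On cocycles the term of the homotopy that begins with the differential of `I` vanishes; the
  -- remaining one becomes the coboundary of `y`.
  have key : fibreCocycle f a i t φ =
      y ≫ (((globalSections _ R).mapHomologicalComplex _).obj J).toCycles p i +
        fibreCocycle f a i t ψ := by
    rw [← cancel_mono (HomologicalComplex.iCycles _ _), Preadditive.add_comp, Category.assoc,
      HomologicalComplex.toCycles_i, fibreCocycle_iCycles, fibreCocycle_iCycles]
    have hc : (φ.f i).hom.app (op ((etalePullback f).obj T)) =
        (I.d i ((ComplexShape.up ℕ).next i)).hom.app _ ≫ (h.hom _ i).hom.app _ +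
        (h.hom i p).hom.app _ ≫
          ((pushforward (geomFibreι f a) R).map (J.d p i)).hom.app _ +
        (ψ.f i).hom.app (op ((etalePullback f).obj T)) :=
      congrArg (fun p ↦ p.hom.app (op ((etalePullback f).obj T))) (h.comm i)
    have hn := restrictToFibre_naturality f a t (J.d p i)
    exact (comp_comp_eq_add hc (iCycles_app_d f i _)).trans
      (congrArg (· + fibreCochain f a i t ψ) (comp_comp_comp_of_square hn).symm)
  rw [key, Preadditive.add_comp, Category.assoc, HomologicalComplex.toCycles_comp_homologyπ,
    comp_zero, zero_add]

end

variable {f a i} {M : ModuleCat.{u} R}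

/-- The germs of the classes of cocycles exhaust the stalk of a higher direct image. -/
lemma exists_germ_homologyπ_eq (I : InjectiveResolution (constSheaf X M))
    (v : stalk a (higherDirectImage f i (constSheaf X M))) :
    ∃ (T : U.Etale) (t : (Scheme.pointSmallEtale a).fiber.obj T)
      (z : ((((pushforward f R).mapHomologicalComplex _).obj I.cocomplex).cycles i).obj.obj
        (op T)),
      germ a _ T t ((I.isoRightDerivedObj (pushforward f R) i).inv.hom.app (op T)
          (((((pushforward f R).mapHomologicalComplex _).obj
            I.cocomplex).homologyπ i).hom.app (op T) z)) = v := by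
  let p : (((pushforward f R).mapHomologicalComplex _).obj I.cocomplex).cycles i ⟶
      higherDirectImage f i (constSheaf X M) :=
    (((pushforward f R).mapHomologicalComplex _).obj I.cocomplex).homologyπ i ≫
      (I.isoRightDerivedObj (pushforward f R) i).inv
  have : Epi p := epi_homologyπ_isoRightDerivedObj_inv I (pushforward f R) i
  -- Being a left adjoint, the stalk functor preserves the epimorphism from cocycles to cohomology.
  have := Functor.preservesEpimorphisms_of_adjunction
    ((Scheme.pointSmallEtale a).skyscraperSheafAdjunction (A := ModuleCat.{u} R))
  have hp : Epi ((Scheme.pointSmallEtale a).sheafFiber.map p) := Functor.map_epi _ p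
  obtain ⟨w, hw⟩ := (ModuleCat.epi_iff_surjective _).1 hp v
  obtain ⟨T, t, z, rfl⟩ := exists_germ_eq a _ w
  exact ⟨T, t, z, ((Scheme.pointSmallEtale a).toPresheafFiber_naturality_apply p.hom T t
    z).symm.trans hw⟩

/-- The base change isomorphism is unique. -/
theorem IsBaseChangeIso.unique
    {e e' : stalk a (higherDirectImage f i (constSheaf X M)) ≃ₗ[R]
      etaleCohomology (geomFibre f a) i (constSheaf (geomFibre f a) M)}
    (he : IsBaseChangeIso f a M i e) (he' : IsBaseChangeIso f a M i e') : e = e' := by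
  obtain ⟨I, J, φ, hφ, h⟩ := he
  obtain ⟨I', J', φ', hφ', h'⟩ := he'
  ext v
  obtain ⟨T, t, z, rfl⟩ := exists_germ_homologyπ_eq I v
  let α := InjectiveResolution.desc (𝟙 _) I' I
  let β := InjectiveResolution.desc (𝟙 _) J' J
  have hα : I.ι.f 0 ≫ α.f 0 = 𝟙 _ ≫ I'.ι.f 0 := InjectiveResolution.desc_commutes_zero _ _ _
  have hβ : J.ι.f 0 ≫ β.f 0 = 𝟙 _ ≫ J'.ι.f 0 := InjectiveResolution.desc_commutes_zero _ _ _
  -- Both maps from `I` to the direct image of `J'` extend the canonical morphism of constant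
  -- sheaves followed by the augmentation of `J'`.
  have H : Homotopy
      (φ ≫ ((pushforward (geomFibreι f a) R).mapHomologicalComplex _).map β) (α ≫ φ') := by
    have := J'.injective
    refine homotopyOfInjective I _ _ ?_
    have h1 : I.ι.f 0 ≫ α.f 0 ≫ φ'.f 0 = constToPushforward (geomFibreι f a) M ≫
        (pushforward (geomFibreι f a) R).map (J'.ι.f 0) := by
      rw [← Category.assoc, hα, Category.id_comp, hφ']
    have h2 : I.ι.f 0 ≫ φ.f 0 ≫ (pushforward (geomFibreι f a) R).map (β.f 0) =
        constToPushforward (geomFibreι f a) M ≫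
          (pushforward (geomFibreι f a) R).map (J'.ι.f 0) := by
      refine (Category.assoc _ _ _).symm.trans ((congrArg
        (· ≫ (pushforward (geomFibreι f a) R).map (β.f 0)) hφ).trans
          ((Category.assoc _ _ _).trans (congrArg _ ?_)))
      exact ((pushforward (geomFibreι f a) R).map_comp _ _).symm.trans
        (congrArg (pushforward (geomFibreι f a) R).map (hβ.trans (Category.id_comp _)))
    exact h2.trans h1.symm
  have hz (w) := ConcreteCategory.congr_hom (fibreCocycle_iCycles f a i t φ) w
  have hz' (w) := ConcreteCategory.congr_hom (fibreCocycle_iCycles f a i t φ') w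
  let αz := (HomologicalComplex.cyclesMap
    (((pushforward f R).mapHomologicalComplex _).map α) i).hom.app (op T) z
  have hI := ConcreteCategory.congr_hom (congrArg (fun p ↦ p.hom.app (op T))
    (homologyπ_isoRightDerivedObj_inv I I' α hα (pushforward f R) i)) z
  have hJ := homologyπ_isoRightDerivedObj_inv J J' β hβ (globalSections _ R) i
  have e₁ := h T t z _ (hz z)
  have e₂ := h' T t αz _ (hz' αz)
  have e₃ : fibreCocycle f a i t φ ≫
      (((globalSections _ R).mapHomologicalComplex _).obj J.cocomplex).homologyπ i ≫
        (J.isoRightDerivedObj (globalSections _ R) i).inv =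
      (HomologicalComplex.cyclesMap
        (((pushforward f R).mapHomologicalComplex _).map α) i).hom.app (op T) ≫
        fibreCocycle f a i t φ' ≫
      (((globalSections _ R).mapHomologicalComplex _).obj J'.cocomplex).homologyπ i ≫
        (J'.isoRightDerivedObj (globalSections _ R) i).inv := by
    rw [hJ, reassoc_of% fibreCocycle_comp_cyclesMap, reassoc_of% cyclesMap_comp_fibreCocycle]
    exact congrArg (· ≫ (J'.isoRightDerivedObj (globalSections _ R) i).inv)
      (fibreCocycle_homologyπ_eq_of_homotopy f a i t H)
  exact e₁.trans ((ConcreteCategory.congr_hom e₃ z).trans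
    (e₂.symm.trans (congrArg (fun q ↦ e' (germ a _ T t q)) hI.symm)))

end BaseChange

/-- If the action of `π₁(U, a)` on `P_n(H^i(X_a, Λ_n))` is transitive, then so is its action on
`P_n` of the stalk of `R^i f_* Λ_n`. -/
theorem TransitiveOnProj.stalk_of_etaleCohomology {X U : Scheme.{u}} {f : X ⟶ U} {K : Type u}
    [Field K] [IsSepClosed K] {a : Spec (.of K) ⟶ U} {ℓ n i : ℕ}
    {M : ModuleCat.{u} (Lam.{u} ℓ n)}
    (h : TransitiveOnProj ℓ n
      (etaleCohomology (geomFibre f a) i (constSheaf (geomFibre f a) M))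
      (CohomologyMonodromy f a M i)) :
    TransitiveOnProj ℓ n (stalk a (higherDirectImage f i (constSheaf X M)))
      (Monodromy a (higherDirectImage f i (constSheaf X M))) := by
  obtain ⟨⟨P₀⟩, hP⟩ := h
  -- A base change isomorphism is available only as part of an instance of the action, here the one
  -- for the pair (P₀, P₀).
  obtain ⟨σ₀, v₀, -, -, -, e, he, -⟩ := hP P₀ P₀
  have mem {v} : e v ∈ starSet ℓ n _ ↔ v ∈ starSet ℓ n _ := by
    change ℓ ^ (n - 1) • e v ≠ 0 ↔ ℓ ^ (n - 1) • v ≠ 0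
    rw [← map_nsmul, Ne, EmbeddingLike.map_eq_zero_iff]
  have mem' (w : starSet ℓ n
      (etaleCohomology (geomFibre f a) i (constSheaf (geomFibre f a) M))) :
      e.symm w.1 ∈ starSet ℓ n _ := mem.1 (by rw [e.apply_symm_apply]; exact w.2)
  have mk_eq {v : starSet ℓ n _} {w : starSet ℓ n _}
      (hw : ProjSet.mk ℓ n w = ProjSet.mk ℓ n ⟨e v.1, mem.2 v.2⟩) :
      ProjSet.mk ℓ n ⟨e.symm w.1, mem' w⟩ = ProjSet.mk ℓ n v := by
    obtain ⟨c, rfl⟩ := Quotient.exact hw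
    refine Quotient.sound ⟨c, Subtype.ext ?_⟩
    exact ((e.symm.map_smul (c : Lam.{u} ℓ n) (e v.1)).trans
      (congrArg _ (e.symm_apply_apply v.1))).symm
  refine ⟨⟨.mk ℓ n ⟨_, mem' v₀⟩⟩, fun P Q ↦ ?_⟩
  obtain ⟨v, rfl⟩ := Quotient.exists_rep P
  obtain ⟨w, rfl⟩ := Quotient.exists_rep Q
  obtain ⟨σ, v', w', hv, hw, e', he', hσ⟩ :=
    hP (.mk ℓ n ⟨e v.1, mem.2 v.2⟩) (.mk ℓ n ⟨e w.1, mem.2 w.2⟩)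
  -- The isomorphism obtained for this pair of classes is the `e` fixed above, so both classes are
  -- transported by the same map.
  obtain rfl := he.unique he'
  exact ⟨σ, ⟨_, mem' v'⟩, ⟨_, mem' w'⟩, mk_eq hv, mk_eq hw, hσ⟩

/-- A scheme with a dominant morphism from a connected scheme is connected. -/
lemma connectedSpace_of_isDominant {Y C : Scheme.{u}} (j : Y ⟶ C) [IsDominant j]
    [ConnectedSpace Y] : ConnectedSpace C :=
  have := (j.denseRange : DenseRange j).preconnectedSpace j.continuous
  { toNonempty := Nonempty.map j inferInstance }

end TowerCurves

end

theorem mainTheorem8 {k : Type u} [Field k] (p : ℕ) [Fact p.Prime] [CharP k p]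
    (ℓ : ℕ) [Fact ℓ.Prime] (hℓ : ℓ ≠ p) (n : ℕ) (hn : 1 ≤ n)
    -- the smooth curve `U` over `k` with a geometric point `a`
    {U : Scheme.{u}} (π : U ⟶ Spec (.of k)) (hU : IsSmoothCurve π)
    {K : Type u} [Field K] [IsSepClosed K] (a : Spec (.of K) ⟶ U)
    -- the finite étale `U`-scheme `U_n` and its regular projectivisation `C_n`
    (Un : FinEt U) {Cn : Scheme.{u}} (q : Cn ⟶ Spec (.of k)) (j : Un.obj.left ⟶ Cn)
    (hCn : IsRegularProjectivisation (Un.obj.hom ≫ π) q j) :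
    -- the general case: `U_n` represents `P_n(V)`
    (∀ (b : ℕ) (V : EtSheaf U (Lam.{u} ℓ n)), IsLocallyConstantFree V b →
      RepresentsProj ℓ n V Un →
      TransitiveOnProj ℓ n (stalk a V) (Monodromy a V) →
      ConnectedSpace Cn) ∧
    -- the case of a family: `U_n` represents `P_n(R^i f_* Λ_n)`
    (∀ (X : Scheme.{u}) (f : X ⟶ U), Smooth f → IsProper f → ∀ i : ℕ,
      RepresentsProj ℓ n
        (higherDirectImage f i (constSheaf X (LamMod.{u} ℓ n))) Un →
      TransitiveOnProj ℓ n
        (etaleCohomology (geomFibre f a) i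
          (constSheaf (geomFibre f a) (LamMod.{u} ℓ n)))
        (CohomologyMonodromy f a (LamMod.{u} ℓ n) i) →
      ConnectedSpace Cn) := by
  have := hU.connected
  have := hCn.dominant
  have main (V : EtSheaf U (Lam.{u} ℓ n)) (hV : RepresentsProj ℓ n V Un)
      (h : TransitiveOnProj ℓ n (stalk a V) (Monodromy a V)) : ConnectedSpace Cn := by
    have := h.connectedSpace hV
    exact connectedSpace_of_isDominant j
  exact ⟨fun _ V _ hV h ↦ main V hV h,
    fun X f _ _ i hV h ↦ main _ hV h.stalk_of_etaleCohomology⟩
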